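/- Let $F$ be a totally real number field with absolute Galois group $G_F=\mathrm{Gal}(\overline F/F)$, let $\ell$ be a prime number, let $K$ be a finite field of characteristic $\ell$ and $L/K$ a finite (Galois) extension, with the discrete topology. Let $\rho:G_F\to \mathrm{GL}_2(L)$ be a continuous representation. An inner twist of (the equivalence class of) $\rho$ is a pair $(\gamma,\epsilon)$ with $\gamma\in\mathrm{Gal}(L/K)$ and $\epsilon:G_F\to L^\times$ a continuous character such that ${}^{\gamma}\rho=\gamma\circ\rho$ is conjugate by an element of $\mathrm{GL}_2(L)$ to $\rho\otimes\epsilon$. Let $\mathfrak L$ be a prime of $F$ above $\ell$, let $I_{\mathfrak L}\subset G_F$ be the inertia group of a prime $\mathfrak P$ of $\overline F$ above $\mathfrak L$, and let $\chi_\ell$ be the mod-$\ell$ cyclotomic character. For $n\ge 1$, a fundamental character of niveau $n$ of $I_{\mathfrak L}$ is a character $\varphi_n:I_{\mathfrak L}\to\overline L^\times$ obtained from the tame character $\sigma\mapsto \sigma(\varpi)/\varpi \bmod \mathfrak P$, where $\varpi^{\ell^n-1}=\pi$ for a uniformizer $\pi$ at $\mathfrak L$, by an embedding of the residue field of $\mathfrak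 P$ into $\overline L$. Let $h\ge 1$ and $t$ be integers, and let $a_0,\dots,a_{2h-1}$ be integers such that $0\le a_i<\frac{\ell-1}{4}$ for all $i$ and $a_0+a_h=a_1+a_{h+1}=\dots=a_{h-1}+a_{2h-1}$. Suppose that, over $\overline L$, one of the following two holds: (1) $\displaystyle(\rho\otimes\chi_\ell^t)|_{I_{\mathfrak L}}\simeq\begin{pmatrix}\varphi_{2h}^{b}&*\\0&\varphi_{2h}^{b\ell^h}\end{pmatrix}$, where $\varphi_{2h}$ is a fundamental character of niveau $2h$ and $b=a_0+a_1\ell+\dots+a_{2h-1}\ell^{2h-1}$; (2) $\displaystyle(\rho\otimes\chi_\ell^t)|_{I_{\mathfrak L}}\simeq\begin{pmatrix}\varphi_{h}^{a}&*\\0&\varphi_{h}^{b}\end{pmatrix}$, where $\varphi_{h}$ is a fundamental character of niveau $h$, $a=a_0+a_1\ell+\dots+a_{h-1}\ell^{h-1}$ and $b=a_h+a_{h+1}\ell+\dots+a_{2h-1}\ell^{h-1}$. Then for every inner twist $(\gamma,\epsilon)$ of $\rho$ the character $\epsilon$ is unramified at $\mathfrak L$, i.e. trivial on the inertia groups at $\mathfrak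 L$. -/

import Mathlib

open scoped NumberField

namespace InnerTwist

/-! ### Two-dimensional representations of a group over a field -/

section Representations

variable {G k k' : Type*} [Group G] [Field k] [Field k']

/-- The twist `ρ ⊗ χ` of a representation `ρ : G → GL₂(k)` by a character `χ : G → kˣ`,
i.e. `σ ↦ χ(σ) ρ(σ)`. -/
def twist (ρ : G →* GL (Fin 2) k) (χ : G →* kˣ) : G →* GL (Fin 2) k where
  toFun σ := Matrix.GeneralLinearGroup.scalar (Fin 2) (χ σ) * ρ σ
  map_one' := by simp
  map_mul' σ τ := by
    rw [map_mul, map_mul, map_mul, mul_assoc, mul_assoc, ← mul_assoc (ρ σ),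
      ← Matrix.GeneralLinearGroup.scalar_commute, mul_assoc]

/-- The representation `f ∘ ρ` obtained from `ρ : G → GL₂(k)` by applying a homomorphism of fields
`f : k → k'` to the matrix entries. -/
def mapCoeff (f : k →+* k') (ρ : G →* GL (Fin 2) k) : G →* GL (Fin 2) k' :=
  (Matrix.GeneralLinearGroup.map f).comp ρ

/-- Two representations `G → GL₂(k)` are equivalent if they are conjugate by an element of
`GL₂(k)`. -/
def Equivalent (ρ ρ' : G →* GL (Fin 2) k) : Prop :=
  ∃ g : GL (Fin 2) k, ∀ σ : G, ρ' σ = g * ρ σ * g⁻¹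

/-- `ρ` is equivalent to an upper triangular representation with diagonal characters `χ₁`, `χ₂`
(in this order). -/
def IsUpperTriangular (ρ : G →* GL (Fin 2) k) (χ₁ χ₂ : G →* kˣ) : Prop :=
  ∃ ρ' : G →* GL (Fin 2) k, Equivalent ρ ρ' ∧
    ∀ σ : G, ∃ c : k, (ρ' σ : Matrix (Fin 2) (Fin 2) k) = !![(χ₁ σ : k), c; 0, (χ₂ σ : k)]

end Representations

/-- Let `L / K` be a field extension, `γ ∈ Gal(L/K)` and `ε : G → Lˣ` a continuous character.
The pair `(γ, ε)` is an inner twist of (the class of) `ρ : G → GL₂(L)` if the representations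
`^γρ` and `ρ ⊗ ε` are equivalent. -/
def IsInnerTwist {G K L : Type*} [Group G] [TopologicalSpace G] [Field K] [Field L]
    [TopologicalSpace L] [Algebra K L] (ρ : G →ₜ* GL (Fin 2) L) (γ : Gal(L/K)) (ε : G →ₜ* Lˣ) :
    Prop :=
  Equivalent (mapCoeff (γ : L →+* L) (ρ : G →* GL (Fin 2) L))
    (twist (ρ : G →* GL (Fin 2) L) (ε : G →* Lˣ))

/-! ### Inertia groups and characters of the absolute Galois group of a number field -/

section Galois

variable (F : Type*) [Field F]

/-- The absolute Galois group of `F` (with the Krull topology). -/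
abbrev AbsGal : Type _ := Gal(AlgebraicClosure F/F)

/-- The ring of all algebraic integers in an algebraic closure of `F`. -/
abbrev IntBar : Type _ := 𝓞 (AlgebraicClosure F)

variable {F}

/-- The inertia group of a prime `𝔓` of the ring of all algebraic integers: the automorphisms
`σ` with `σ x ≡ x` modulo `𝔓` for all algebraic integers `x`.  If `𝔓` lies above the prime `𝔏`
of `F`, this is the inertia group at `𝔏`, which is determined by `𝔏` up to conjugation. -/
noncomputable abbrev inertiaAt (𝔓 : Ideal (IntBar F)) : Subgroup (AbsGal F) := 𝔓.inertia (AbsGal F)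

/-- A character of the absolute Galois group is unramified at the prime `𝔏` if it is trivial on
the inertia groups at `𝔏`. -/
def IsUnramifiedAt {A : Type*} [Group A] (ε : AbsGal F →* A) (𝔏 : Ideal (𝓞 F)) : Prop :=
  ∀ 𝔓 : Ideal (IntBar F), 𝔓.IsPrime → 𝔓.LiesOver 𝔏 → ∀ σ ∈ inertiaAt 𝔓, ε σ = 1

/-- The mod `ℓ` cyclotomic character `χ_ℓ` of the absolute Galois group of `F`
(of characteristic zero), with values in the units of a field `k` of characteristic `ℓ`. -/
noncomputable def cyclo (F : Type*) [Field F] [CharZero F] (ℓ : ℕ) [Fact ℓ.Prime]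
    (k : Type*) [Field k] [CharP k ℓ] : AbsGal F →* kˣ :=
  (Units.map (ZMod.castHom (dvd_refl ℓ) k : ZMod ℓ →* k)).comp
    ((modularCyclotomicCharacter (AlgebraicClosure F)
      (n := ℓ) (HasEnoughRootsOfUnity.natCard_rootsOfUnity (AlgebraicClosure F) ℓ)).comp
      (MulSemiringAction.toRingAut (AbsGal F) (AlgebraicClosure F)))

/-- Let `𝔏` be a prime of `F` above `ℓ`, and `𝔓` a prime of the ring of all algebraic integers
above `𝔏`.  A character `φ` of the inertia group at `𝔓` is a fundamental character of niveau `n`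
if, for `π` a uniformizer at `𝔏` and `ϖ` a root of order `ℓⁿ - 1` of `π`, it is the composite of
the tame character `σ ↦ (σ(ϖ) / ϖ mod 𝔓)`, with values in the field with `ℓⁿ` elements inside the
residue field of `𝔓`, and an embedding of residue fields.  (On inertia, the tame character depends
neither on `π` nor on `ϖ`.) -/
def IsFundamentalCharacter (ℓ n : ℕ) (𝔏 : Ideal (𝓞 F)) (𝔓 : Ideal (IntBar F))
    {k : Type*} [Field k] (φ : inertiaAt 𝔓 →* kˣ) : Prop :=
  ∃ (π : 𝓞 F) (ϖ : IntBar F) (τ : (IntBar F ⧸ 𝔓) →+* k),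
    π ∈ 𝔏 ∧ π ∉ 𝔏 ^ 2 ∧ ϖ ^ (ℓ ^ n - 1) = algebraMap (𝓞 F) (IntBar F) π ∧
    ∀ σ : inertiaAt 𝔓, ∃ ζ : IntBar F,
      (σ : AbsGal F) • ϖ = ζ * ϖ ∧ (φ σ : k) = τ (Ideal.Quotient.mk 𝔓 ζ)

/-- The restriction of `ρ ⊗ χ_ℓ ^ t` to the inertia group at `𝔓`, with coefficients extended
to an algebraic closure of `L`. -/
noncomputable def twistedInertiaRep [CharZero F] (ℓ : ℕ) [Fact ℓ.Prime] {L : Type*} [Field L]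
    [CharP L ℓ] (ρ : AbsGal F →* GL (Fin 2) L) (t : ℤ) (𝔓 : Ideal (IntBar F)) :
    inertiaAt 𝔓 →* GL (Fin 2) (AlgebraicClosure L) :=
  mapCoeff (algebraMap L (AlgebraicClosure L))
    ((twist ρ (cyclo F ℓ L ^ t)).comp (inertiaAt 𝔓).subtype)

end Galois

end InnerTwist

/-! An automorphism `γ` of `L` over the finite field `K` is `x ↦ x ^ ℓ ^ s`. It fixes the values of
`χ_ℓ ^ t`, which lie in the prime field, so on inertia the traces and determinants of an inner twist
show that raising the diagonal characters `φ ^ X`, `φ ^ Y` to the power `ℓ ^ s` permutes them up to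
multiplication by `ε`.

The condition on the sums of the `a i` makes the determinant `φ ^ (X + Y)` Frobenius-invariant,
hence `ε ^ 2 = 1`. Squaring then removes `ε`: `2 * X * ℓ ^ s ≡ 2 * Z` modulo `ℓ ^ n - 1` with `Z`
equal to `X` or `Y`. Multiplication by `ℓ` permutes base-`ℓ` digits cyclically, so both `X * ℓ ^ s`
and `Z` have digits below `(ℓ - 1) / 4`; twice such a number stays below the modulus, the factor 2
cancels, and `ε = 1` (`eq_one_of_smallDigits`).

Passing from characters to exponents requires a value of `φ` of exact order `ℓ ^ n - 1`. It comes
from the ramification of the Kummer extension generated by the roots of `X ^ N - π` with `N = ℓ ^ n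
- 1` (`exists_mem_inertia_smul_eq`), lifted to the algebraic closure by
`exists_mem_inertia_extending`. -/

open scoped Pointwise

namespace InnerTwist

/-! ### Inertia groups in infinite Galois extensions. -/

section Lifting

variable (F Ω : Type*) [Field F] [Field Ω] [Algebra F Ω]

lemma coe_smul_ringOfIntegers (σ : Gal(Ω/F)) (x : 𝓞 Ω) : ((σ • x : 𝓞 Ω) : Ω) = σ (x : Ω) := rfl

lemma smulCommClass_ringOfIntegers : SMulCommClass Gal(Ω/F) (𝓞 F) (𝓞 Ω) where
  smul_comm σ a x := by
    apply NumberField.RingOfIntegers.ext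
    simp only [coe_smul_ringOfIntegers, Algebra.smul_def, map_mul]
    exact congrArg (· * σ (x : Ω)) (σ.commutes (a : F))

lemma isInvariant_ringOfIntegers [IsGalois F Ω] :
    Algebra.IsInvariant (𝓞 F) (𝓞 Ω) Gal(Ω/F) where
  isInvariant x hx := by
    have h : (x : Ω) ∈ (⊥ : IntermediateField F Ω) := by
      rw [InfiniteGalois.mem_bot_iff_fixed]
      intro σ
      exact congrArg (algebraMap (𝓞 Ω) Ω) (hx σ)
    obtain ⟨y, hy⟩ := IntermediateField.mem_bot.mp h
    have hy' : IsIntegral ℤ y := by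
      refine (isIntegral_algHom_iff ((algebraMap F Ω).toIntAlgHom)
        (algebraMap F Ω).injective).mp ?_
      simpa [hy] using NumberField.RingOfIntegers.isIntegral_coe x
    exact ⟨⟨y, hy'⟩, NumberField.RingOfIntegers.ext hy⟩

/-- Stabilizers of algebraic elements are open; this gives access to the results on invariants of
profinite groups, with the discrete topology on the ring of integers. -/
lemma continuousSMul_ringOfIntegers [Algebra.IsIntegral F Ω] [TopologicalSpace (𝓞 Ω)]
    [DiscreteTopology (𝓞 Ω)] : ContinuousSMul Gal(Ω/F) (𝓞 Ω) := by
  rw [continuousSMul_iff_stabilizer_isOpen]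
  intro x
  convert stabilizer_isOpen_of_isIntegral (K := F) (x : Ω)
  ext σ
  exact NumberField.RingOfIntegers.ext_iff

variable {F Ω}

/-- The Galois group acts transitively on the primes of the ring of integers above a given
prime of the base. -/
lemma exists_smul_eq_of_under_eq [IsGalois F Ω] (P Q : Ideal (𝓞 Ω)) [P.IsPrime] [Q.IsPrime]
    (h : P.under (𝓞 F) = Q.under (𝓞 F)) : ∃ σ : Gal(Ω/F), Q = σ • P := by
  let _ : TopologicalSpace (𝓞 Ω) := ⊥
  have : DiscreteTopology (𝓞 Ω) := ⟨rfl⟩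
  have := smulCommClass_ringOfIntegers F Ω
  have := isInvariant_ringOfIntegers F Ω
  have := continuousSMul_ringOfIntegers F Ω
  exact Algebra.IsInvariant.exists_smul_of_under_eq_of_profinite P Q h

/-- Automorphisms of the residue field at `P`, trivial on the residue field below, are induced by
elements of the decomposition group. -/
lemma exists_smul_sub_smul_mem [IsGalois F Ω] (P : Ideal (𝓞 Ω)) [P.IsPrime]
    {G : Type*} [Group G] [MulSemiringAction G (𝓞 Ω)] (σ : G) (hσ : σ • P = P)
    (h : ∀ x : 𝓞 F, σ • algebraMap (𝓞 F) (𝓞 Ω) x - algebraMap (𝓞 F) (𝓞 Ω) x ∈ P) :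
    ∃ g : Gal(Ω/F), g • P = P ∧ ∀ x, g • x - σ • x ∈ P := by
  let _ : TopologicalSpace (𝓞 Ω) := ⊥
  have : DiscreteTopology (𝓞 Ω) := ⟨rfl⟩
  have := smulCommClass_ringOfIntegers F Ω
  have := isInvariant_ringOfIntegers F Ω
  have := continuousSMul_ringOfIntegers F Ω
  let e : (𝓞 Ω ⧸ P) ≃+* (𝓞 Ω ⧸ P) :=
    Ideal.quotientEquiv P P (MulSemiringAction.toRingEquiv G (𝓞 Ω) σ) hσ.symm
  let e' : (𝓞 Ω ⧸ P) ≃ₐ[𝓞 F ⧸ P.under (𝓞 F)] (𝓞 Ω ⧸ P) := AlgEquiv.ofRingEquiv (f := e) (by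
    intro x
    obtain ⟨x, rfl⟩ := Ideal.Quotient.mk_surjective x
    exact Ideal.Quotient.eq.mpr (h x))
  obtain ⟨g, hg⟩ := Ideal.Quotient.stabilizerHom_surjective_of_profinite (G := Gal(Ω/F))
    (P.under (𝓞 F)) P e'
  refine ⟨g, g.2, fun x => Ideal.Quotient.eq.mp ?_⟩
  exact congrArg (fun f => f (Ideal.Quotient.mk P x)) hg

/-- The inertia groups of an extension surject onto the inertia groups of a normal
subextension. -/
lemma exists_mem_inertia_extending [IsGalois F Ω] (E : IntermediateField F Ω) [Normal F E]
    (P : Ideal (𝓞 Ω)) [P.IsPrime] (s : Gal(E/F)) (hs : s ∈ (P.under (𝓞 E)).inertia Gal(E/F)) :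
    ∃ σ ∈ P.inertia Gal(Ω/F), ∀ x : E, σ (x : Ω) = s x := by
  set σ₀ : Gal(Ω/F) := s.liftNormal Ω
  have hσ₀ : ∀ x : E, σ₀ (x : Ω) = s x := fun x => s.liftNormal_commutes Ω x
  have hσ₀' : ∀ x : 𝓞 E, σ₀ • algebraMap (𝓞 E) (𝓞 Ω) x = algebraMap (𝓞 E) (𝓞 Ω) (s • x) :=
    fun x => NumberField.RingOfIntegers.ext (hσ₀ (x : E))
  have hinv : ∀ x : 𝓞 E, σ₀⁻¹ • algebraMap (𝓞 E) (𝓞 Ω) x = algebraMap (𝓞 E) (𝓞 Ω) (s⁻¹ • x) :=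
    fun x => by rw [inv_smul_eq_iff, hσ₀', smul_inv_smul]
  have hmem : ∀ t ∈ (P.under (𝓞 E)).inertia Gal(E/F), ∀ x : 𝓞 E,
      -- The target is to correct the lift `σ₀` by elements of `Gal(Ω/E)`, which do not affect its
      -- restriction to `E`: `g` makes it stabilize `P`, then `k` makes it trivial on the residue
      -- ring.
      algebraMap (𝓞 E) (𝓞 Ω) (t • x) - algebraMap (𝓞 E) (𝓞 Ω) x ∈ P := fun t ht x => by
    rw [← map_sub]; exact ht x
  obtain ⟨g, hg⟩ := exists_smul_eq_of_under_eq (F := E) (σ₀ • P) P (by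
    ext x
    rw [Ideal.under, Ideal.mem_comap, Ideal.mem_comap, Ideal.mem_pointwise_smul_iff_inv_smul_mem,
      hinv]
    have hm := hmem _ (inv_mem hs) x
    exact ⟨fun h => by simpa using P.sub_mem h hm, fun h => by simpa using P.add_mem hm h⟩)
  set σ₁ : Gal(Ω/F) := g.restrictScalars F * σ₀
  have hσ₁ : σ₁ • P = P := by
    conv_rhs => rw [hg]
    exact mul_smul _ _ _
  have hgE : ∀ (g : Gal(Ω/E)) (x : E), g (x : Ω) = x := fun g x => g.commutes x
  obtain ⟨k, hk, hk'⟩ := exists_smul_sub_smul_mem (F := E) P σ₁ hσ₁ (by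
    intro x
    have : σ₁ • algebraMap (𝓞 E) (𝓞 Ω) x = algebraMap (𝓞 E) (𝓞 Ω) (s • x) := by
      rw [mul_smul, hσ₀']
      exact NumberField.RingOfIntegers.ext (hgE g _)
    rw [this]
    exact hmem s hs x)
  refine ⟨(k.restrictScalars F)⁻¹ * σ₁, fun x => ?_, fun x => ?_⟩
  · have h1 := hk' x
    rw [← hk, Ideal.mem_pointwise_smul_iff_inv_smul_mem, smul_sub, inv_smul_smul] at h1
    have h2 := P.neg_mem h1
    rw [neg_sub] at h2
    rw [mul_smul]
    exact h2
  · change k.symm (g (σ₀ (x : Ω))) = _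
    rw [hσ₀, hgE, AlgEquiv.symm_apply_eq, hgE]

end Lifting

/-! ### Tame ramification in a finite Kummer extension. -/

section FiniteLevel

variable {F E : Type*} [Field F] [NumberField F] [Field E] [NumberField E] [Algebra F E]

lemma exists_eq_pow_mul_of_pow_eq_pow {R : Type*} [CommRing R] [IsDomain R] {N : ℕ} [NeZero N]
    {ζ x y : R} (hζ : IsPrimitiveRoot ζ N) (h : x ^ N = y ^ N) : ∃ i < N, x = ζ ^ i * y := by
  have h1 := hζ.pow_sub_pow_eq_prod_sub_mul x y (NeZero.pos N)
  rw [h, sub_self, eq_comm, Finset.prod_eq_zero_iff] at h1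
  obtain ⟨ξ, hξ, h2⟩ := h1
  rw [Polynomial.mem_nthRootsFinset (NeZero.pos N)] at hξ
  obtain ⟨i, hi, rfl⟩ := hζ.eq_pow_of_pow_eq_one hξ
  exact ⟨i, hi, sub_eq_zero.mp h2⟩

/-- Up to a factor `j` outside `p`, every element of `p` is a multiple of `π`, whose image is the
`N`-th power of an element of `P`. As `j` stays outside `P`, this gives `p ⊆ P ^ N` after extension
to `𝓞 E`. -/
lemma le_ramificationIdx_of_pow_eq (p : Ideal (𝓞 F)) [p.IsPrime]
    (P : Ideal (𝓞 E)) [P.IsPrime] [P.LiesOver p] {π : 𝓞 F} (hπ : π ∈ p) (hπ' : π ∉ p ^ 2)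
    {N : ℕ} {ϖ : 𝓞 E} (hϖ : ϖ ^ N = algebraMap (𝓞 F) (𝓞 E) π) :
    N ≤ P.ramificationIdx (𝓞 F) := by
  have hπ0 : π ≠ 0 := by rintro rfl; exact hπ' (zero_mem _)
  have hp0 : p ≠ ⊥ := by rintro rfl; exact hπ0 hπ
  have hϖP : ϖ ∈ P := by
    refine ‹P.IsPrime›.mem_of_pow_mem N ?_
    rw [hϖ]
    exact (Ideal.mem_of_liesOver P p π).mp hπ
  obtain ⟨J, hJ⟩ : p ∣ Ideal.span {π} := Ideal.dvd_span_singleton.mpr hπ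
  obtain ⟨j, hjJ, hj⟩ : ∃ j ∈ J, j ∉ p := by
    by_contra! hc
    apply hπ'
    have : π ∈ p * J := hJ ▸ Ideal.mem_span_singleton_self π
    rw [pow_two]
    exact Ideal.mul_mono_right hc this
  have hle : p.map (algebraMap (𝓞 F) (𝓞 E)) ≤ P ^ N := by
    rw [Ideal.map_le_iff_le_comap]
    intro x hx
    rw [Ideal.mem_comap]
    have hxj : x * j ∈ Ideal.span {π} := hJ ▸ Ideal.mul_mem_mul hx hjJ
    obtain ⟨c, hc⟩ := Ideal.mem_span_singleton'.mp hxj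
    have : algebraMap (𝓞 F) (𝓞 E) j * algebraMap (𝓞 F) (𝓞 E) x ∈ P ^ N := by
      rw [← map_mul, mul_comm, ← hc, map_mul, ← hϖ]
      exact Ideal.mul_mem_left _ _ (Ideal.pow_mem_pow hϖP N)
    refine (Ideal.IsPrime.mul_mem_pow P this).resolve_left fun h => hj ?_
    exact (Ideal.mem_of_liesOver P p j).mpr h
  have h0 : p.map (algebraMap (𝓞 F) (𝓞 E)) ≠ ⊥ := Ideal.map_ne_bot_of_ne_bot hp0
  have hP0 : P ≠ ⊥ := Ideal.ne_bot_of_liesOver_of_ne_bot hp0 P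
  rw [Ideal.IsDedekindDomain.ramificationIdx_eq_multiplicity p P h0]
  refine FiniteMultiplicity.le_multiplicity_of_pow_dvd ?_ (Ideal.dvd_iff_le.mpr hle)
  exact FiniteMultiplicity.of_prime_left (Ideal.prime_of_isPrime hP0 ‹_›) h0

/-- A totally ramified Kummer extension of exponent prime to the residue characteristic: every
root of unity is attained by the tame character. -/
lemma exists_mem_inertia_smul_eq [IsGalois F E] (p : Ideal (𝓞 F)) [p.IsPrime]
    (P : Ideal (𝓞 E)) [P.IsPrime] [P.LiesOver p] {π : 𝓞 F} (hπ : π ∈ p) (hπ' : π ∉ p ^ 2)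
    {N : ℕ} (hN : (N : 𝓞 E) ∉ P) {ϖ ζ : 𝓞 E} (hϖ : ϖ ^ N = algebraMap (𝓞 F) (𝓞 E) π)
    (hζ : IsPrimitiveRoot ζ N)
    (hgen : ∀ s : Gal(E/F), s • ϖ = ϖ → s • ζ = ζ → s = 1) :
    ∃ s ∈ P.inertia Gal(E/F), s • ϖ = ζ * ϖ := by
  have hN0 : N ≠ 0 := by rintro rfl; exact hN (by simp)
  have : NeZero N := ⟨hN0⟩
  have hπ0 : π ≠ 0 := by rintro rfl; exact hπ' (zero_mem _)
  have hp0 : p ≠ ⊥ := by rintro rfl; exact hπ0 hπ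
  have hϖ0 : ϖ ≠ 0 := by
    rintro rfl
    rw [zero_pow hN0, eq_comm, map_eq_zero_iff _ (FaithfulSMul.algebraMap_injective _ _)] at hϖ
    exact hπ0 hϖ
  have : p.IsMaximal := Ideal.IsPrime.isMaximal ‹_› hp0
  have : Finite (𝓞 F ⧸ p) := Ideal.finiteQuotientOfFreeOfNeBot p hp0
  have : Finite p.ResidueField := Finite.of_surjective _
    (Ideal.bijective_algebraMap_quotient_residueField p).surjective
  have hcard : N ≤ Nat.card (P.inertia Gal(E/F)) := by
    rw [Ideal.card_inertia_eq_ramificationIdxIn p P,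
      Ideal.ramificationIdxIn_eq_ramificationIdx p P Gal(E/F)]
    exact le_ramificationIdx_of_pow_eq p P hπ hπ' hϖ
  -- Since `N` is nonzero modulo `P`, reduction is injective on `N`-th roots of unity, so inertia
  -- must fix `ζ`.
  have hζP : IsPrimitiveRoot (Ideal.Quotient.mk P ζ) N := by
    have : NeZero (N : 𝓞 E ⧸ P) :=
      ⟨fun h => hN (Ideal.Quotient.eq_zero_iff_mem.mp (by simpa using h))⟩
    have h1 := (hζ.isRoot_cyclotomic (NeZero.pos N)).map (f := Ideal.Quotient.mk P)
    rwa [Polynomial.map_cyclotomic, Polynomial.isRoot_cyclotomic_iff] at h1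
  have hfix : ∀ s ∈ P.inertia Gal(E/F), s • ζ = ζ := fun s hs => by
    obtain ⟨i, hi, hi'⟩ := hζ.eq_pow_of_pow_eq_one (ξ := s • ζ) (by
      rw [← smul_pow', hζ.pow_eq_one, smul_one])
    have h1 : Ideal.Quotient.mk P (s • ζ) = Ideal.Quotient.mk P ζ := Ideal.Quotient.eq.mpr (hs ζ)
    rw [← hi', map_pow] at h1
    by_cases hN1 : N = 1
    · subst hN1
      rw [IsPrimitiveRoot.one_right_iff.mp hζ, smul_one]
    · have := hζP.pow_inj hi (j := 1) (by omega) (by rw [h1, pow_one])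
      rw [← hi', this, pow_one]
  have hfixπ : ∀ s : Gal(E/F), (s • ϖ) ^ N = ϖ ^ N := fun s => by
    rw [← smul_pow', hϖ, smul_algebraMap]
  have hex : ∀ s : P.inertia Gal(E/F), ∃ i : Fin N, (s : Gal(E/F)) • ϖ = ζ ^ (i : ℕ) * ϖ := by
    intro s
    obtain ⟨i, hi, h⟩ := exists_eq_pow_mul_of_pow_eq_pow hζ (hfixπ s)
    exact ⟨⟨i, hi⟩, h⟩
  choose f hf using hex
  have hinj : Function.Injective f := by
    intro s t hst
    have h1 : (t : Gal(E/F)) • ϖ = (s : Gal(E/F)) • ϖ := by rw [hf, hf, hst]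
    have h2 := hgen ((s : Gal(E/F))⁻¹ * t) (by rw [mul_smul, h1, inv_smul_smul])
      (hfix _ (mul_mem (inv_mem s.2) t.2))
    exact Subtype.ext (inv_mul_eq_one.mp h2)
  -- Inertia embeds into the exponents modulo `N` and has at least `N` elements, so every exponent
  -- occurs.
  have hsurj : Function.Surjective f := by
    have hc : Nat.card (P.inertia Gal(E/F)) = Nat.card (Fin N) :=
      le_antisymm (Nat.card_le_card_of_injective f hinj) (by simpa using hcard)
    exact ((Nat.bijective_iff_injective_and_card f).mpr ⟨hinj, hc⟩).surjective
  -- For `N = 1` this index is 0, so the exponent agrees with 1 only modulo the order of `ζ`.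
  obtain ⟨s, hs⟩ := hsurj (Fin.ofNat N 1)
  refine ⟨s, s.2, ?_⟩
  rw [hf, hs, Fin.val_ofNat]
  congr 1
  conv_rhs => rw [← pow_one ζ]
  rw [← pow_mod_orderOf ζ 1, ← hζ.eq_orderOf]

end FiniteLevel

/-! ### The exact order of fundamental characters. -/

section TameCharacter

variable {F : Type*} [Field F] [NumberField F]

-- The splitting field `E` of `X ^ N - π` is a finite extension to which
-- `exists_mem_inertia_smul_eq` applies; the element of inertia found there then lifts.
open Polynomial in
lemma exists_mem_inertiaAt_smul_eq (𝔏 : Ideal (𝓞 F)) [𝔏.IsPrime] (𝔓 : Ideal (IntBar F))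
    [𝔓.IsPrime] [𝔓.LiesOver 𝔏] {π : 𝓞 F} (hπ : π ∈ 𝔏) (hπ' : π ∉ 𝔏 ^ 2) {N : ℕ}
    (hN : (N : IntBar F) ∉ 𝔓) {ϖ : IntBar F}
    (hϖ : ϖ ^ N = algebraMap (𝓞 F) (IntBar F) π) :
    ∃ ζ : IntBar F, IsPrimitiveRoot ζ N ∧ ∃ σ ∈ inertiaAt 𝔓, σ • ϖ = ζ * ϖ := by
  have hN0 : N ≠ 0 := by rintro rfl; exact hN (by simp)
  have : NeZero N := ⟨hN0⟩
  have hπ0 : π ≠ 0 := by rintro rfl; exact hπ' (zero_mem _)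
  obtain ⟨z, hz⟩ := HasEnoughRootsOfUnity.exists_primitiveRoot (AlgebraicClosure F) N
  have hϖΩ : (ϖ : AlgebraicClosure F) ^ N = algebraMap F _ (π : F) :=
    congrArg (algebraMap (IntBar F) (AlgebraicClosure F)) hϖ
  have hπF : (π : F) ≠ 0 := by simpa using hπ0
  have hϖ0 : (ϖ : AlgebraicClosure F) ≠ 0 := fun h => by
    rw [h, zero_pow hN0, eq_comm, map_eq_zero] at hϖΩ
    exact hπF hϖΩ
  set f : F[X] := X ^ N - C (π : F)
  have hf : ∀ x : AlgebraicClosure F, x ∈ f.rootSet (AlgebraicClosure F) ↔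
      x ^ N = algebraMap F _ (π : F) := fun x => by
    rw [mem_rootSet_of_ne (X_pow_sub_C_ne_zero (NeZero.pos N) _)]
    simp [sub_eq_zero]
  let E : IntermediateField F (AlgebraicClosure F) :=
    IntermediateField.adjoin F (f.rootSet (AlgebraicClosure F))
  have hsplit : f.IsSplittingField F E :=
    IntermediateField.adjoin_rootSet_isSplittingField (IsAlgClosed.splits _)
  have : FiniteDimensional F E := IsSplittingField.finiteDimensional E f
  have : Normal F E := Normal.of_isSplittingField f
  have : IsGalois F E := ⟨⟩
  have : NumberField E := NumberField.of_module_finite F E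
  have hϖE : (ϖ : AlgebraicClosure F) ∈ E :=
    IntermediateField.subset_adjoin _ _ ((hf _).mpr hϖΩ)
  -- The root of unity `z` is the quotient of the two roots `z * ϖ` and `ϖ`.
  have hzE : z ∈ E := by
    have : z * ϖ ∈ E := IntermediateField.subset_adjoin _ _ ((hf _).mpr (by
      rw [mul_pow, hz.pow_eq_one, one_mul, hϖΩ]))
    simpa [hϖ0] using div_mem this hϖE
  have hint : ∀ (x : AlgebraicClosure F) (hx : x ∈ E), IsIntegral ℤ x →
      IsIntegral ℤ (⟨x, hx⟩ : E) := fun x hx h =>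
    (isIntegral_algHom_iff (algebraMap E (AlgebraicClosure F)).toIntAlgHom
        (algebraMap E (AlgebraicClosure F)).injective).mp h
  let ϖE : 𝓞 E := ⟨⟨ϖ, hϖE⟩, hint _ _ ϖ.2⟩
  let ζE : 𝓞 E := ⟨⟨z, hzE⟩, hint _ _ (hz.isIntegral (NeZero.pos N))⟩
  have hinj : Function.Injective (algebraMap (𝓞 E) (IntBar F)) :=
    FaithfulSMul.algebraMap_injective _ _
  have hinjΩ : Function.Injective (algebraMap (IntBar F) (AlgebraicClosure F)) :=
    FaithfulSMul.algebraMap_injective _ _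
  have hζ : IsPrimitiveRoot (algebraMap (𝓞 E) (IntBar F) ζE) N :=
    IsPrimitiveRoot.of_map_of_injective (f := algebraMap (IntBar F) (AlgebraicClosure F)) hz hinjΩ
  have hϖE' : algebraMap (𝓞 E) (IntBar F) ϖE = ϖ := rfl
  obtain ⟨s, hs, hs'⟩ := exists_mem_inertia_smul_eq 𝔏 (𝔓.under (𝓞 E)) hπ hπ' (N := N)
    (ϖ := ϖE) (ζ := ζE) (by simpa [Ideal.under, Ideal.mem_comap] using hN)
    (by
      apply hinj
      rw [map_pow, hϖE', hϖ]
      rfl)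
    (IsPrimitiveRoot.of_map_of_injective hζ hinj) (by
      intro s h1 h2
      have h1' : s ⟨ϖ, hϖE⟩ = ⟨ϖ, hϖE⟩ := congrArg (algebraMap (𝓞 E) E) h1
      have h2' : s ⟨z, hzE⟩ = ⟨z, hzE⟩ := congrArg (algebraMap (𝓞 E) E) h2
      have : (s : E →ₐ[F] E) = AlgHom.id F E := by
        refine IntermediateField.algHom_ext_of_eq_adjoin F (S := E) rfl fun x hx => ?_
        obtain ⟨i, -, hi⟩ := exists_eq_pow_mul_of_pow_eq_pow hz
          (((hf x).mp hx).trans hϖΩ.symm)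
        have hx' : (⟨x, IntermediateField.subset_adjoin _ _ hx⟩ : E)
            = (⟨z, hzE⟩ : E) ^ i * ⟨ϖ, hϖE⟩ := Subtype.ext hi
        change s _ = _
        rw [hx', map_mul, map_pow, h1', h2']
        rfl
      exact AlgEquiv.ext fun x => DFunLike.congr_fun this x)
  obtain ⟨σ, hσ, hσ'⟩ := exists_mem_inertia_extending E 𝔓 s hs
  refine ⟨_, hζ, σ, hσ, ?_⟩
  apply NumberField.RingOfIntegers.ext
  have h1 : s ⟨ϖ, hϖE⟩ = ⟨z, hzE⟩ * ⟨ϖ, hϖE⟩ := congrArg (algebraMap (𝓞 E) E) hs'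
  exact (hσ' ⟨ϖ, hϖE⟩).trans (congrArg (algebraMap E (AlgebraicClosure F)) h1)

/-- A fundamental character of niveau `n` takes values in the group of `(ℓ ^ n - 1)`-th roots of
unity, and attains a primitive one. -/
lemma IsFundamentalCharacter.pow_eq_one_and_exists_orderOf_eq {ℓ n : ℕ} [Fact ℓ.Prime] (hn : n ≠ 0)
    {𝔏 : Ideal (𝓞 F)} [𝔏.IsPrime] {𝔓 : Ideal (IntBar F)}
    [𝔓.IsPrime] [𝔓.LiesOver 𝔏] {k : Type*} [Field k] [CharP k ℓ] {φ : inertiaAt 𝔓 →* kˣ}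
    (hφ : IsFundamentalCharacter ℓ n 𝔏 𝔓 φ) :
    (∀ σ, φ σ ^ (ℓ ^ n - 1) = 1) ∧ ∃ σ, orderOf (φ σ) = ℓ ^ n - 1 := by
  obtain ⟨π, ϖ, τ, hπ, hπ', hϖ, hσ⟩ := hφ
  have hℓ : 1 < ℓ := (Fact.out : ℓ.Prime).one_lt
  have hq : 1 < ℓ ^ n := Nat.one_lt_pow hn hℓ
  set N := ℓ ^ n - 1 with hNdef
  have hNq : N + 1 = ℓ ^ n := by omega
  have hN0 : N ≠ 0 := by omega
  have : NeZero N := ⟨hN0⟩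
  -- `N` is `-1` in characteristic `ℓ`.
  have hNk : (N : k) ≠ 0 := fun h => by
    have h1 : ((N + 1 : ℕ) : k) = 0 := by rw [hNq]; simp [hn]
    rw [Nat.cast_add, h] at h1
    simp at h1
  have hN𝔓 : (N : IntBar F) ∉ 𝔓 := fun h => by
    apply hNk
    have := congrArg τ (Ideal.Quotient.eq_zero_iff_mem.mpr h)
    simpa using this
  have hϖ0 : ϖ ≠ 0 := by
    rintro rfl
    rw [zero_pow hN0, eq_comm, map_eq_zero_iff _ (FaithfulSMul.algebraMap_injective _ _)] at hϖ
    exact hπ' (hϖ ▸ zero_mem _)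
  have : SMulCommClass (AbsGal F) (𝓞 F) (IntBar F) := smulCommClass_ringOfIntegers _ _
  refine ⟨fun σ => ?_, ?_⟩
  · obtain ⟨ζ, h1, h2⟩ := hσ σ
    have h3 : ζ ^ N = 1 := by
      have : ζ ^ N * ϖ ^ N = 1 * ϖ ^ N := by
        rw [← mul_pow, ← h1, ← smul_pow', hϖ, smul_algebraMap, one_mul]
      exact mul_right_cancel₀ (pow_ne_zero _ hϖ0) this
    ext
    rw [Units.val_pow_eq_pow_val, h2, ← map_pow, ← map_pow, h3, map_one, map_one, Units.val_one]
  · obtain ⟨ζ, hζ, σ, hσ', hσϖ⟩ := exists_mem_inertiaAt_smul_eq 𝔏 𝔓 hπ hπ' hN𝔓 hϖ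
    obtain ⟨ζ', h1, h2⟩ := hσ ⟨σ, hσ'⟩
    have h3 : ζ' = ζ := mul_right_cancel₀ hϖ0 (h1.symm.trans hσϖ)
    refine ⟨⟨σ, hσ'⟩, ?_⟩
    have : NeZero (N : k) := ⟨hNk⟩
    have h4 := (hζ.isRoot_cyclotomic (NeZero.pos N)).map (f := τ.comp (Ideal.Quotient.mk 𝔓))
    rw [Polynomial.map_cyclotomic, Polynomial.isRoot_cyclotomic_iff, RingHom.comp_apply, ← h3,
      ← h2] at h4
    rw [← orderOf_units, ← h4.eq_orderOf]

end TameCharacter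

/-! ### Base-`ℓ` digits modulo `ℓ ^ n - 1`. -/

section Digits

/-- `X` is congruent modulo `ℓ ^ n - 1` to a number whose `n` digits in base `ℓ` are smaller than
`(ℓ - 1) / 4`. -/
def HasSmallDigits (ℓ n X : ℕ) : Prop :=
  ∃ c : ℕ → ℕ, (∀ i < n, 4 * c i + 1 < ℓ) ∧
    X ≡ ∑ i ∈ Finset.range n, c i * ℓ ^ i [MOD ℓ ^ n - 1]

lemma pow_modEq_one_sub_one {q : ℕ} (hq : 0 < q) : q ≡ 1 [MOD q - 1] :=
  (Nat.modEq_iff_dvd' hq).mpr dvd_rfl |>.symm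

/-- Multiplication by the base permutes the digits cyclically. -/
lemma HasSmallDigits.mul_base {ℓ n X : ℕ} (hℓ : 0 < ℓ) (hX : HasSmallDigits ℓ n X) :
    HasSmallDigits ℓ n (X * ℓ) := by
  obtain ⟨c, hc, hX⟩ := hX
  obtain _ | m := n
  · exact ⟨c, by simp, by simpa using hX.mul_right ℓ⟩
  refine ⟨fun i => if i = 0 then c m else c (i - 1), fun i hi => ?_, (hX.mul_right ℓ).trans ?_⟩
  · dsimp only
    split_ifs
    · exact hc m (by omega)
    · exact hc _ (by omega)
  -- The leading term becomes `c m * ℓ ^ (m + 1)`, congruent to `c m`: the top digit wraps around to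
  -- the bottom.
  · have h : ∑ i ∈ Finset.range (m + 1), (if i = 0 then c m else c (i - 1)) * ℓ ^ i =
        (∑ i ∈ Finset.range m, c i * ℓ ^ i) * ℓ + c m := by
      rw [Finset.sum_range_succ', Finset.sum_mul]
      simp [pow_succ, mul_assoc]
    rw [Finset.sum_range_succ, h, add_mul, mul_assoc, ← pow_succ]
    simpa using ((pow_modEq_one_sub_one (pow_pos hℓ (m + 1))).mul_left (c m)).add_left _

lemma HasSmallDigits.mul_base_pow {ℓ n X : ℕ} (hℓ : 0 < ℓ) (hX : HasSmallDigits ℓ n X) (s : ℕ) :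
    HasSmallDigits ℓ n (X * ℓ ^ s) := by
  induction s with
  | zero => simpa using hX
  | succ s ih => rw [pow_succ, ← mul_assoc]; exact ih.mul_base hℓ

lemma two_mul_sum_digits_lt {ℓ n : ℕ} (hℓ : 1 < ℓ) (hn : n ≠ 0) {c : ℕ → ℕ}
    (hc : ∀ i < n, 4 * c i + 1 < ℓ) :
    2 * ∑ i ∈ Finset.range n, c i * ℓ ^ i < ℓ ^ n - 1 := by
  have h1 : ∀ m ≤ n, 4 * ∑ i ∈ Finset.range m, c i * ℓ ^ i + 1 ≤ ℓ ^ m := by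
    intro m hm
    induction m with
    | zero => simp
    | succ m ih =>
      rw [Finset.sum_range_succ, pow_succ]
      have h2 := Nat.mul_le_mul_left (ℓ ^ m) (hc m hm).le
      have h3 := ih (by omega)
      linarith
  have := h1 n le_rfl
  have : 1 < ℓ ^ n := Nat.one_lt_pow hn hℓ
  omega

/-- For odd `ℓ` the modulus is even and 2 is not invertible. Cancellation works because the doubled
small-digit representatives are still below the modulus, so they are equal as integers. -/
lemma HasSmallDigits.modEq_of_two_mul_modEq {ℓ n X Y : ℕ} (hℓ : 1 < ℓ) (hn : n ≠ 0)
    (hX : HasSmallDigits ℓ n X) (hY : HasSmallDigits ℓ n Y)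
    (h : 2 * X ≡ 2 * Y [MOD ℓ ^ n - 1]) : X ≡ Y [MOD ℓ ^ n - 1] := by
  obtain ⟨c, hc, hX⟩ := hX
  obtain ⟨d, hd, hY⟩ := hY
  have h1 := ((hX.mul_left 2).symm.trans h).trans (hY.mul_left 2)
  have h2 := h1.eq_of_lt_of_lt (two_mul_sum_digits_lt hℓ hn hc) (two_mul_sum_digits_lt hℓ hn hd)
  rw [Nat.eq_of_mul_eq_mul_left two_pos h2] at hX
  exact hX.trans hY.symm

end Digits

/-! ### From equalities of characters to congruences of exponents. -/

section Characters

/-- A group is not the union of two proper subgroups, here the equalizers of `f` with `g₁` and `g₂`.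
-/
lemma eq_or_eq_of_forall_eq_or_eq {G H : Type*} [Group G] [Group H] {f g₁ g₂ : G →* H}
    (h : ∀ x, f x = g₁ x ∨ f x = g₂ x) : f = g₁ ∨ f = g₂ := by
  by_contra! hc
  obtain ⟨x, hx⟩ := DFunLike.ne_iff.mp hc.1
  obtain ⟨y, hy⟩ := DFunLike.ne_iff.mp hc.2
  have hx' := (h x).resolve_left hx
  have hy' := (h y).resolve_right hy
  rcases h (x * y) with h | h
  · rw [map_mul, map_mul, hy'] at h
    exact hx (mul_right_cancel h)
  · rw [map_mul, map_mul, hx'] at h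
    exact hy (mul_left_cancel h)

/-- If raising to the power `ℓ ^ s` preserves the pair of characters `φ ^ X`, `φ ^ Y` up to the
character `ε`, where `X` and `Y` have small digits and raising to the power `ℓ` fixes the determinant `φ ^ (X + Y)`,
then `ε` is trivial. -/
lemma eq_one_of_smallDigits {I A : Type*} [Group I] [CommGroup A] {φ ε : I →* A} {ℓ n X Y s : ℕ}
    (hℓ : 1 < ℓ) (hn : n ≠ 0) (hφ : ∀ σ, φ σ ^ (ℓ ^ n - 1) = 1)
    (hφ' : ∃ σ, orderOf (φ σ) = ℓ ^ n - 1)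
    (hX : HasSmallDigits ℓ n X) (hY : HasSmallDigits ℓ n Y)
    (hXY : (X + Y) * ℓ ≡ X + Y [MOD ℓ ^ n - 1])
    (hdet : ∀ σ, ((φ ^ X) σ * (φ ^ Y) σ) ^ ℓ ^ s = ε σ ^ 2 * ((φ ^ X) σ * (φ ^ Y) σ))
    (hdiag : ∀ σ, (φ ^ X) σ ^ ℓ ^ s = ε σ * (φ ^ X) σ ∨ (φ ^ X) σ ^ ℓ ^ s = ε σ * (φ ^ Y) σ) :
    ε = 1 := by
  have hmod : ∀ {a b : ℕ}, a ≡ b [MOD ℓ ^ n - 1] → ∀ σ, φ σ ^ a = φ σ ^ b := fun h σ =>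
    pow_eq_pow_iff_modEq.mpr (h.of_dvd (orderOf_dvd_of_pow_eq_one (hφ σ)))
  have hXYs : (X + Y) * ℓ ^ s ≡ X + Y [MOD ℓ ^ n - 1] := by
    clear hdet hdiag
    induction s with
    | zero => simp [Nat.ModEq.refl]
    | succ s ih =>
      rw [pow_succ, ← mul_assoc]
      exact (ih.mul_right ℓ).trans hXY
  have hε2 : ∀ σ, ε σ ^ 2 = 1 := fun σ => by
    have h := hdet σ
    rw [MonoidHom.pow_apply, MonoidHom.pow_apply, ← pow_add, ← pow_mul, hmod hXYs] at h
    exact right_eq_mul.mp h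
  -- Squaring eliminates `ε`, and an element where `φ` has full order turns the result into a
  -- congruence.
  have key : ∀ Z, HasSmallDigits ℓ n Z → (∀ σ, φ σ ^ (X * ℓ ^ s) = ε σ * φ σ ^ Z) → ε = 1 := by
    intro Z hZ h
    obtain ⟨σ, hσ⟩ := hφ'
    have h2 : φ σ ^ (2 * (X * ℓ ^ s)) = φ σ ^ (2 * Z) := by
      rw [mul_comm 2, mul_comm 2, pow_mul _ _ 2, pow_mul _ _ 2, h, mul_pow, hε2, one_mul]
    rw [pow_eq_pow_iff_modEq, hσ] at h2
    have h3 := HasSmallDigits.modEq_of_two_mul_modEq hℓ hn (hX.mul_base_pow (by omega) s) hZ h2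
    ext σ
    have h4 := h σ
    rw [hmod h3] at h4
    exact right_eq_mul.mp h4
  -- A priori the choice between `X` and `Y` depends on `σ`; it can be made uniformly.
  have := eq_or_eq_of_forall_eq_or_eq (f := φ ^ (X * ℓ ^ s)) (g₁ := ε * φ ^ X) (g₂ := ε * φ ^ Y)
    (fun σ => by simpa [pow_mul] using hdiag σ)
  rcases this with h | h
  · exact key X hX fun σ => DFunLike.congr_fun h σ
  · exact key Y hY fun σ => DFunLike.congr_fun h σ

end Characters

/-! ### Frobenius invariance of the determinant exponent. -/

section Exponents

variable {ℓ h : ℕ} {a : ℕ → ℕ}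

/-- The sum is `(a 0 + a h) * (1 + ℓ + ⋯ + ℓ ^ (h - 1))`: all digits are equal, so a cyclic shift
changes nothing. -/
lemma sum_add_sum_mul_modEq (hℓ : 1 < ℓ) (hsum : ∀ i < h, a i + a (h + i) = a 0 + a h) :
    (∑ i ∈ Finset.range h, a i * ℓ ^ i + ∑ i ∈ Finset.range h, a (h + i) * ℓ ^ i) * ℓ ≡
      ∑ i ∈ Finset.range h, a i * ℓ ^ i + ∑ i ∈ Finset.range h, a (h + i) * ℓ ^ i
      [MOD ℓ ^ h - 1] := by
  have h1 : ∑ i ∈ Finset.range h, a i * ℓ ^ i + ∑ i ∈ Finset.range h, a (h + i) * ℓ ^ i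
      = (a 0 + a h) * ∑ i ∈ Finset.range h, ℓ ^ i := by
    rw [← Finset.sum_add_distrib, Finset.mul_sum]
    refine Finset.sum_congr rfl fun i hi => ?_
    rw [← add_mul, hsum i (Finset.mem_range.mp hi)]
  have h2 : (∑ i ∈ Finset.range h, ℓ ^ i) * ℓ ≡ ∑ i ∈ Finset.range h, ℓ ^ i [MOD ℓ ^ h - 1] := by
    have h3 : (∑ i ∈ Finset.range h, ℓ ^ i) * ℓ + 1 = ∑ i ∈ Finset.range h, ℓ ^ i + ℓ ^ h := by
      rw [← Finset.sum_range_succ, Finset.sum_range_succ', Finset.sum_mul]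
      simp [pow_succ]
    refine Nat.ModEq.add_right_cancel' 1 ?_
    rw [h3]
    exact (pow_modEq_one_sub_one (by positivity)).add_left _
  rw [h1, mul_assoc]
  exact h2.mul_left _

lemma sum_range_two_mul :
    ∑ i ∈ Finset.range (2 * h), a i * ℓ ^ i = ∑ i ∈ Finset.range h, a i * ℓ ^ i +
      (∑ i ∈ Finset.range h, a (h + i) * ℓ ^ i) * ℓ ^ h := by
  rw [two_mul, Finset.sum_range_add, Finset.sum_mul]
  congr 1
  refine Finset.sum_congr rfl fun i _ => ?_
  rw [pow_add]; ring

/-- As `ℓ ^ (2 * h) ≡ 1`, the sum is congruent to `(A + B) * (ℓ ^ h + 1)`; the congruence modulo `ℓ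
^ h - 1` is multiplied by `ℓ ^ h + 1`. -/
lemma sum_range_two_mul_modEq (hℓ : 1 < ℓ) (hsum : ∀ i < h, a i + a (h + i) = a 0 + a h) :
    (∑ i ∈ Finset.range (2 * h), a i * ℓ ^ i +
      (∑ i ∈ Finset.range (2 * h), a i * ℓ ^ i) * ℓ ^ h) * ℓ ≡
    ∑ i ∈ Finset.range (2 * h), a i * ℓ ^ i +
      (∑ i ∈ Finset.range (2 * h), a i * ℓ ^ i) * ℓ ^ h [MOD ℓ ^ (2 * h) - 1] := by
  rw [sum_range_two_mul]
  set A := ∑ i ∈ Finset.range h, a i * ℓ ^ i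
  set B := ∑ i ∈ Finset.range h, a (h + i) * ℓ ^ i
  have hq : ℓ ^ h * ℓ ^ h ≡ 1 [MOD ℓ ^ (2 * h) - 1] := by
    rw [← pow_add, ← two_mul]
    exact pow_modEq_one_sub_one (by positivity)
  have h1 : A + B * ℓ ^ h + (A + B * ℓ ^ h) * ℓ ^ h ≡ (A + B) * (ℓ ^ h + 1)
      [MOD ℓ ^ (2 * h) - 1] := by
    have := (hq.mul_left B).add_left (A + (A + B) * ℓ ^ h)
    convert this using 1 <;> ring
  have h2 : (A + B) * ℓ * (ℓ ^ h + 1) ≡ (A + B) * (ℓ ^ h + 1) [MOD ℓ ^ (2 * h) - 1] := by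
    have h3 := (sum_add_sum_mul_modEq hℓ hsum).mul_right' (ℓ ^ h + 1)
    have h4 : (ℓ ^ h - 1) * (ℓ ^ h + 1) = ℓ ^ (2 * h) - 1 := by
      rw [mul_comm, ← Nat.sq_sub_sq, ← pow_mul, mul_comm h, one_pow]
    rwa [h4] at h3
  refine (h1.mul_right ℓ).trans (Nat.ModEq.trans ?_ (h2.trans h1.symm))
  rw [show (A + B) * (ℓ ^ h + 1) * ℓ = (A + B) * ℓ * (ℓ ^ h + 1) by ring]

end Exponents

/-! ### Traces, determinants and Frobenius. -/

section Traces

variable {G k : Type*} [Group G] [Field k]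

lemma Equivalent.trace_eq {ρ ρ' : G →* GL (Fin 2) k} (h : Equivalent ρ ρ') (σ : G) :
    (ρ' σ : Matrix (Fin 2) (Fin 2) k).trace = (ρ σ : Matrix (Fin 2) (Fin 2) k).trace := by
  obtain ⟨g, hg⟩ := h
  rw [hg, Units.val_mul, Units.val_mul, Matrix.trace_units_conj]

lemma Equivalent.det_eq {ρ ρ' : G →* GL (Fin 2) k} (h : Equivalent ρ ρ') (σ : G) :
    (ρ' σ : Matrix (Fin 2) (Fin 2) k).det = (ρ σ : Matrix (Fin 2) (Fin 2) k).det := by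
  obtain ⟨g, hg⟩ := h
  rw [hg, Units.val_mul, Units.val_mul, Matrix.det_units_conj]

lemma IsUpperTriangular.trace_eq {ρ : G →* GL (Fin 2) k} {χ₁ χ₂ : G →* kˣ}
    (h : IsUpperTriangular ρ χ₁ χ₂) (σ : G) :
    (ρ σ : Matrix (Fin 2) (Fin 2) k).trace = χ₁ σ + χ₂ σ := by
  obtain ⟨ρ', h1, h2⟩ := h
  obtain ⟨c, hc⟩ := h2 σ
  rw [← h1.trace_eq, hc, Matrix.trace_fin_two_of]

lemma IsUpperTriangular.det_eq {ρ : G →* GL (Fin 2) k} {χ₁ χ₂ : G →* kˣ}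
    (h : IsUpperTriangular ρ χ₁ χ₂) (σ : G) :
    (ρ σ : Matrix (Fin 2) (Fin 2) k).det = χ₁ σ * χ₂ σ := by
  obtain ⟨ρ', h1, h2⟩ := h
  obtain ⟨c, hc⟩ := h2 σ
  rw [← h1.det_eq, hc, Matrix.det_fin_two_of, mul_zero, sub_zero]

lemma coe_twist (ρ : G →* GL (Fin 2) k) (χ : G →* kˣ) (σ : G) :
    (twist ρ χ σ : Matrix (Fin 2) (Fin 2) k) =
      (χ σ : k) • (ρ σ : Matrix (Fin 2) (Fin 2) k) := by
  change (Matrix.GeneralLinearGroup.scalar (Fin 2) (χ σ) * ρ σ).val = _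
  rw [Units.val_mul, Matrix.GeneralLinearGroup.coe_scalar, Matrix.scalar_apply,
    ← Matrix.smul_eq_diagonal_mul]

lemma coe_mapCoeff {k' : Type*} [Field k'] (f : k →+* k') (ρ : G →* GL (Fin 2) k) (σ : G) :
    (mapCoeff f ρ σ : Matrix (Fin 2) (Fin 2) k') = (ρ σ : Matrix (Fin 2) (Fin 2) k).map f := rfl

end Traces

/-- An automorphism of a finite field of characteristic `ℓ` is a power of the Frobenius. -/
lemma exists_forall_eq_pow {K L : Type*} (ℓ : ℕ) [Fact ℓ.Prime] [Field K] [Finite K] [CharP K ℓ]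
    [Field L] [Algebra K L] [FiniteDimensional K L] (γ : Gal(L/K)) :
    ∃ s : ℕ, ∀ x, γ x = x ^ ℓ ^ s := by
  have := Fintype.ofFinite K
  have : Finite L := Module.finite_of_finite K
  obtain ⟨m, -, hm⟩ := FiniteField.card K ℓ
  obtain ⟨i, hi⟩ := (FiniteField.bijective_frobeniusAlgEquivOfAlgebraic_pow K L).surjective γ
  refine ⟨m * i, fun x => ?_⟩
  rw [← hi]
  change (FiniteField.frobeniusAlgEquivOfAlgebraic K L ^ (i : ℕ)) x = _
  rw [AlgEquiv.coe_pow, FiniteField.coe_frobeniusAlgEquivOfAlgebraic_iterate, hm, pow_mul]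

/-- The mod `ℓ` cyclotomic character takes values in the prime field. -/
lemma cyclo_pow_eq {F : Type*} [Field F] [CharZero F] {ℓ : ℕ} [Fact ℓ.Prime] {k : Type*} [Field k]
    [CharP k ℓ] (σ : AbsGal F) : cyclo F ℓ k σ ^ ℓ = cyclo F ℓ k σ := by
  obtain ⟨u, hu⟩ : ∃ u : (ZMod ℓ)ˣ,
      cyclo F ℓ k σ = Units.map (ZMod.castHom (dvd_refl ℓ) k : ZMod ℓ →* k) u := ⟨_, rfl⟩
  rw [hu, ← map_pow]
  congr 1
  ext
  rw [Units.val_pow_eq_pow_val, ZMod.pow_card]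

lemma eq_or_eq_of_add_eq_of_mul_eq {k : Type*} [Field k] {x y u v : k} (h : x + y = u + v)
    (h' : x * y = u * v) : x = u ∨ x = v := by
  have : (x - u) * (x - v) = 0 := by linear_combination x * h - h'
  simpa [sub_eq_zero] using this

/-! ### Inner twists restricted to inertia. -/

section Unramified

variable {F K L : Type*} [Field F] [NumberField F] {ℓ : ℕ} [Fact ℓ.Prime]
  [Field K] [Finite K] [CharP K ℓ] [Field L] [CharP L ℓ] [Algebra K L] [FiniteDimensional K L]

/-- A character with commutative values is trivial on all inertia groups at a prime if it is
trivial on one of them. -/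
lemma isUnramifiedAt_of_forall_mem_inertiaAt {A : Type*} [CommGroup A] {ε : AbsGal F →* A}
    {𝔏 : Ideal (𝓞 F)} (𝔓 : Ideal (IntBar F)) [𝔓.IsPrime] [𝔓.LiesOver 𝔏]
    (h : ∀ σ ∈ inertiaAt 𝔓, ε σ = 1) : IsUnramifiedAt ε 𝔏 := by
  intro 𝔔 h𝔔 h𝔔' σ hσ
  obtain ⟨g, rfl⟩ := exists_smul_eq_of_under_eq (F := F) 𝔓 𝔔
    ((𝔓.over_def 𝔏).symm.trans (𝔔.over_def 𝔏))
  have h1 : g⁻¹ * σ * g ∈ inertiaAt 𝔓 := fun x => by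
    have h2 := hσ (g • x)
    have h3 := Ideal.mem_pointwise_smul_iff_inv_smul_mem.mp h2
    rwa [smul_sub, inv_smul_smul, ← mul_smul, ← mul_smul] at h3
  have h4 := h _ h1
  rwa [map_mul, map_mul, mul_right_comm, map_inv, inv_mul_cancel, one_mul] at h4

/-- If the restriction of `ρ` to inertia is, up to a power of the cyclotomic character, triangular
with diagonal given by powers of a fundamental character whose exponents have small digits, then
inner twists are unramified. -/
lemma IsInnerTwist.isUnramifiedAt [TopologicalSpace L] {ρ : AbsGal F →ₜ* GL (Fin 2) L}
    {γ : Gal(L/K)} {ε : AbsGal F →ₜ* Lˣ} (htwist : IsInnerTwist ρ γ ε)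
    {𝔏 : Ideal (𝓞 F)} [𝔏.IsPrime] {𝔓 : Ideal (IntBar F)} [𝔓.IsPrime] [𝔓.LiesOver 𝔏]
    {n X Y : ℕ} (hn : n ≠ 0) {t : ℤ} {φ : inertiaAt 𝔓 →* (AlgebraicClosure L)ˣ}
    (hφ : IsFundamentalCharacter ℓ n 𝔏 𝔓 φ)
    (hρ : IsUpperTriangular (twistedInertiaRep ℓ (ρ : AbsGal F →* GL (Fin 2) L) t 𝔓)
      (φ ^ X) (φ ^ Y))
    (hX : HasSmallDigits ℓ n X) (hY : HasSmallDigits ℓ n Y)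
    (hXY : (X + Y) * ℓ ≡ X + Y [MOD ℓ ^ n - 1]) :
    IsUnramifiedAt (ε : AbsGal F →* Lˣ) 𝔏 := by
  have hℓ : 1 < ℓ := (Fact.out : ℓ.Prime).one_lt
  have : CharP (AlgebraicClosure L) ℓ := charP_of_injective_algebraMap' L ℓ
  obtain ⟨s, hs⟩ := exists_forall_eq_pow ℓ γ
  obtain ⟨hφ1, hφ2⟩ := hφ.pow_eq_one_and_exists_orderOf_eq hn
  let ε' : inertiaAt 𝔓 →* (AlgebraicClosure L)ˣ :=
    (Units.map (algebraMap L (AlgebraicClosure L) : L →* AlgebraicClosure L)).comp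
      ((ε : AbsGal F →* Lˣ).comp (inertiaAt 𝔓).subtype)
  set M : AbsGal F → Matrix (Fin 2) (Fin 2) L := fun σ => (ρ σ : Matrix (Fin 2) (Fin 2) L)
  set c : AbsGal F → L := fun σ => ((cyclo F ℓ L ^ t) σ : Lˣ)
  -- The cyclotomic twist is invisible to `γ`, so the relations for `ρ` pass to `ρ ⊗ χ_ℓ ^ t` with
  -- the same `ε`.
  have hcs : ∀ σ, c σ ^ ℓ ^ s = c σ := fun σ => by
    have h1 : cyclo F ℓ L σ ^ ℓ ^ s = cyclo F ℓ L σ := by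
      clear hs
      induction s with
      | zero => simp
      | succ s ih => rw [pow_succ, pow_mul, ih, cyclo_pow_eq]
    have h2 : (cyclo F ℓ L ^ t) σ ^ ℓ ^ s = (cyclo F ℓ L ^ t) σ := by
      rw [MonoidHom.zpow_apply, ← zpow_natCast, zpow_comm, zpow_natCast, h1]
    exact (Units.val_pow_eq_pow_val _ _).symm.trans (congrArg Units.val h2)
  have htr : ∀ σ, (M σ).trace ^ ℓ ^ s = ε σ * (M σ).trace := fun σ => by
    have h := Equivalent.trace_eq htwist σ
    rw [coe_twist, coe_mapCoeff, Matrix.trace_smul] at h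
    rw [← hs]
    exact (AddMonoidHom.map_trace (γ : L →+* L) (M σ)).trans h.symm
  have hdet : ∀ σ, (M σ).det ^ ℓ ^ s = (ε σ : L) ^ 2 * (M σ).det := fun σ => by
    have h := Equivalent.det_eq htwist σ
    rw [coe_twist, coe_mapCoeff, Matrix.det_smul, Fintype.card_fin] at h
    rw [← hs]
    exact (RingHom.map_det (γ : L →+* L) (M σ)).trans h.symm
  have hrep : ∀ σ : inertiaAt 𝔓, (twistedInertiaRep ℓ (ρ : AbsGal F →* GL (Fin 2) L) t 𝔓 σ :
      Matrix (Fin 2) (Fin 2) (AlgebraicClosure L)) =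
      (c σ • M σ).map (algebraMap L (AlgebraicClosure L)) := fun σ => by
    rw [twistedInertiaRep, coe_mapCoeff, MonoidHom.comp_apply, coe_twist]
    rfl
  have htr' : ∀ σ : inertiaAt 𝔓, (((φ ^ X) σ : AlgebraicClosure L) + (φ ^ Y) σ) =
      algebraMap L _ (c σ * (M σ).trace) := fun σ => by
    rw [← hρ.trace_eq, hrep, ← smul_eq_mul, ← Matrix.trace_smul]
    exact (AddMonoidHom.map_trace _ _).symm
  have hdet' : ∀ σ : inertiaAt 𝔓, (((φ ^ X) σ : AlgebraicClosure L) * (φ ^ Y) σ) =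
      algebraMap L _ (c σ ^ 2 * (M σ).det) := fun σ => by
    rw [← hρ.det_eq, hrep, ← RingHom.mapMatrix_apply, ← RingHom.map_det, Matrix.det_smul,
      Fintype.card_fin]
  have hdet'' : ∀ σ, ((φ ^ X) σ * (φ ^ Y) σ) ^ ℓ ^ s = ε' σ ^ 2 * ((φ ^ X) σ * (φ ^ Y) σ) := by
    intro σ
    ext
    simp only [Units.val_pow_eq_pow_val, Units.val_mul]
    rw [hdet', ← map_pow, mul_pow, hdet, ← pow_mul, mul_comm 2, pow_mul, hcs,
      show (ε' σ : AlgebraicClosure L) = algebraMap L _ (ε σ : L) from rfl, ← map_pow, ← map_mul]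
    congr 1
    ring
  have hε' : ε' = 1 := by
    refine eq_one_of_smallDigits hℓ hn hφ1 hφ2 hX hY hXY hdet'' fun σ => ?_
    -- Additivity of Frobenius gives the sum, the determinant gives the product, and the two
    -- determine the pair of diagonal values.
    have h1 : ((φ ^ X) σ : AlgebraicClosure L) ^ ℓ ^ s + ((φ ^ Y) σ : AlgebraicClosure L) ^ ℓ ^ s =
        ε' σ * (φ ^ X) σ + ε' σ * (φ ^ Y) σ := by
      rw [← add_pow_char_pow, ← mul_add, htr', ← map_pow, mul_pow, htr, hcs,
        show (ε' σ : AlgebraicClosure L) = algebraMap L _ (ε σ : L) from rfl, ← map_mul]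
      congr 1
      ring
    have h2 : ((φ ^ X) σ : AlgebraicClosure L) ^ ℓ ^ s * ((φ ^ Y) σ : AlgebraicClosure L) ^ ℓ ^ s =
        ε' σ * (φ ^ X) σ * (ε' σ * (φ ^ Y) σ) := by
      have := congrArg Units.val (hdet'' σ)
      simp only [Units.val_pow_eq_pow_val, Units.val_mul] at this
      rw [← mul_pow, this]
      ring
    simp only [Units.ext_iff, Units.val_pow_eq_pow_val, Units.val_mul]
    exact eq_or_eq_of_add_eq_of_mul_eq h1 h2
  refine isUnramifiedAt_of_forall_mem_inertiaAt 𝔓 fun σ hσ => ?_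
  have h := congrArg Units.val (DFunLike.congr_fun hε' ⟨σ, hσ⟩)
  exact Units.ext ((algebraMap L (AlgebraicClosure L)).injective (h.trans (map_one _).symm))

end Unramified
end InnerTwist

theorem mainTheorem11
    {F K L : Type*} [Field F] [NumberField F] [NumberField.IsTotallyReal F]
    (ℓ : ℕ) [Fact ℓ.Prime]
    [Field K] [Finite K] [CharP K ℓ]
    [Field L] [CharP L ℓ] [Algebra K L] [FiniteDimensional K L] [IsGalois K L]
    [TopologicalSpace L] [DiscreteTopology L]
    (ρ : InnerTwist.AbsGal F →ₜ* GL (Fin 2) L)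
    (𝔏 : Ideal (𝓞 F)) [𝔏.IsPrime] (h𝔏 : (ℓ : 𝓞 F) ∈ 𝔏)
    (𝔓 : Ideal (InnerTwist.IntBar F)) [𝔓.IsPrime] [𝔓.LiesOver 𝔏]
    (h : ℕ) (hh : 1 ≤ h) (t : ℤ)
    (a : ℕ → ℕ) (ha : ∀ i < 2 * h, (a i : ℝ) < ((ℓ : ℝ) - 1) / 4)
    (hsum : ∀ i < h, a i + a (h + i) = a 0 + a h) :
    -- niveau `2h`
    ((∃ φ : InnerTwist.inertiaAt 𝔓 →* (AlgebraicClosure L)ˣ,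
        InnerTwist.IsFundamentalCharacter ℓ (2 * h) 𝔏 𝔓 φ ∧
        InnerTwist.IsUpperTriangular
          (InnerTwist.twistedInertiaRep ℓ (ρ : InnerTwist.AbsGal F →* GL (Fin 2) L) t 𝔓)
          (φ ^ (∑ i ∈ Finset.range (2 * h), a i * ℓ ^ i))
          (φ ^ ((∑ i ∈ Finset.range (2 * h), a i * ℓ ^ i) * ℓ ^ h))) →
      ∀ (γ : Gal(L/K)) (ε : InnerTwist.AbsGal F →ₜ* Lˣ), InnerTwist.IsInnerTwist ρ γ ε →
        InnerTwist.IsUnramifiedAt (ε : InnerTwist.AbsGal F →* Lˣ) 𝔏) ∧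
    -- niveau `h`
    ((∃ φ : InnerTwist.inertiaAt 𝔓 →* (AlgebraicClosure L)ˣ,
        InnerTwist.IsFundamentalCharacter ℓ h 𝔏 𝔓 φ ∧
        InnerTwist.IsUpperTriangular
          (InnerTwist.twistedInertiaRep ℓ (ρ : InnerTwist.AbsGal F →* GL (Fin 2) L) t 𝔓)
          (φ ^ (∑ i ∈ Finset.range h, a i * ℓ ^ i))
          (φ ^ (∑ i ∈ Finset.range h, a (h + i) * ℓ ^ i))) →
      ∀ (γ : Gal(L/K)) (ε : InnerTwist.AbsGal F →ₜ* Lˣ), InnerTwist.IsInnerTwist ρ γ ε →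
        InnerTwist.IsUnramifiedAt (ε : InnerTwist.AbsGal F →* Lˣ) 𝔏) := by
  have hℓ : 1 < ℓ := (Fact.out : ℓ.Prime).one_lt
  have ha' : ∀ i < 2 * h, 4 * a i + 1 < ℓ := fun i hi => by
    have := ha i hi
    have : ((4 * a i + 1 : ℕ) : ℝ) < ℓ := by push_cast; linarith
    exact_mod_cast this
  refine ⟨?_, ?_⟩
  · rintro ⟨φ, hφ, hρ⟩ γ ε htwist
    have hX : InnerTwist.HasSmallDigits ℓ (2 * h) (∑ i ∈ Finset.range (2 * h), a i * ℓ ^ i) :=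
      ⟨a, ha', Nat.ModEq.refl _⟩
    -- The second exponent `b * ℓ ^ h` is a cyclic shift of `b`, so its digits are small too.
    exact htwist.isUnramifiedAt (by omega) hφ hρ hX (hX.mul_base_pow (by omega) h)
      (InnerTwist.sum_range_two_mul_modEq hℓ hsum)
  · rintro ⟨φ, hφ, hρ⟩ γ ε htwist
    exact htwist.isUnramifiedAt (by omega) hφ hρ
      ⟨a, fun i hi => ha' i (by omega), Nat.ModEq.refl _⟩
      ⟨fun i => a (h + i), fun i hi => ha' (h + i) (by omega), Nat.ModEq.refl _⟩
      (InnerTwist.sum_add_sum_mul_modEq hℓ hsum)
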